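/- Theorem 1.2. Let $\mathcal R=\mathbb Z[A^{\pm1},d^{-1}]$ with $d=-A^2-A^{-2}$. A ribbon $n$-graph is represented by a planar diagram in $\mathbb R\times[0,1]$ with $n$ boundary points on each of the two lines $\mathbb R\times\{0\}$, $\mathbb R\times\{1\}$, made of vertices (coupons), circles (annuli) and arcs (ribbons, joining vertices and boundary points), with over/under crossings; diagrams are taken with the blackboard framing, up to planar isotopy and the extended Reidemeister moves (cancellation of two opposite curls, the second and the third Reidemeister move, a strand passing over or under a vertex). Let $\mathcal Y_n$ be the quotient of the free $\mathcal R$-module on the ribbon $n$-graphs by the smallest submodule that contains all expressions of the following Yamada relations, in each of which the diagrams are identical outside a small disc. 1. $L = A^4L_0+A^{-4}L_\infty-d\,L_\times$, where $L$ has a crossing in the disc, $L_0$ and $L_\infty$ are its two smoothings (the ones with coefficients $A$ and $A^{-1}$ in the Kauffman bracket relation $L=AL_0+A^{-1}L_\infty$), and in $L_\times$ the crossing is replaced by a four-valent vertex. 2. $G=G/e-d^{-1}(G-e)$ for an edge $e$ that joins two distinct vertices. 3. A loop at a vertex that bounds an empty disc is deleted with the factor $d-d^{-1}$. 4. A circle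 that bounds an empty disc is deleted with the factor $d^2-1$. 5. Vertices of valency less than three: a vertex of valency two is an interior point of a strand, a diagram with a vertex of valency one is zero, and an isolated vertex is deleted with the factor $d$. Putting $G$ over $G'$ defines the product $GG'$, which makes $\mathcal Y_n$ a unital $\mathcal R$-algebra. Number the three top and the three bottom boundary points from left to right, and consider in $\mathcal Y_3$ the crossingless diagrams - $A=1_3$: three vertical strands; - $B$: an arc joining the top points $1,2$, an arc joining the bottom points $1,2$, and a vertical third strand; - $C$: a vertical first strand, an arc joining the top points $2,3$, and an arc joining the bottom points $2,3$; - $F$: a vertical first strand, and a four-valent vertex joined to the top points $2,3$ and the bottom points $2,3$; - $G$: a four-valent vertex joined to the top points $1,2$ and the bottom points $1,2$, and a vertical third strand; - $N$: a six-valent vertex joined to all six boundary points. Then the $\mathcal R$-algebra $\mathcal Y_3$ is generated by the six elements $A,B,C,F,G,N$. -/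

import Mathlib

open scoped LaurentPolynomial

namespace RibbonSkein

/-! ## The coefficient ring `ℤ[A^{±1}, d⁻¹]`, where `d = -A² - A⁻²` -/

/-- The Laurent polynomial `-A² - A⁻²`. -/
noncomputable def dPoly : ℤ[T;T⁻¹] :=
  -LaurentPolynomial.T 2 - LaurentPolynomial.T (-2)

/-- The ring `𝓡 = ℤ[A^{±1}, d⁻¹]`. -/
abbrev Coef : Type := Localization.Away dPoly

/-- The powers `A ^ k`, `k ∈ ℤ`, in `𝓡`. -/
noncomputable def aPow (k : ℤ) : Coef := algebraMap ℤ[T;T⁻¹] Coef (LaurentPolynomial.T k)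

/-- The element `d = -A² - A⁻²` of `𝓡`. -/
noncomputable def d : Coef := algebraMap ℤ[T;T⁻¹] Coef dPoly

/-- The element `d⁻¹` of `𝓡`. -/
noncomputable def dInv : Coef := IsLocalization.Away.invSelf dPoly

/-! ## Planar diagrams of ribbon graphs

A planar diagram in the strip `ℝ × [0, 1]` in general position with respect to the height function
is cut by horizontal lines into slices, each of which holds one elementary piece with vertical
strands on its left and on its right. Diagrams are written as the list of their slices, read from
the top of the strip to its bottom. Ribbons and annuli are drawn by their cores, with the
blackboard framing; coupons are drawn as vertices (points with cyclically ordered legs). -/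

/-- The elementary pieces of a diagram. -/
inductive Piece : Type
  /-- The local minimum `∪` of a ribbon or an annulus. -/
  | cup
  /-- The local maximum `∩` of a ribbon or an annulus. -/
  | cap
  /-- A crossing of two strands. For `crossing true` the over-strand runs from the lower left to
  the upper right, for `crossing false` it runs from the lower right to the upper left. -/
  | crossing (ε : Bool)
  /-- A vertex (coupon) of valency `i + j`, with `i` legs going up and `j` legs going down. -/
  | vertex (i j : ℕ)

/-- The number of end points of a piece on its upper side. -/
def Piece.top : Piece → ℕ
  | .cup => 2
  | .cap => 0
  | .crossing _ => 2
  | .vertex i _ => i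

/-- The number of end points of a piece on its lower side. -/
def Piece.bot : Piece → ℕ
  | .cup => 0
  | .cap => 2
  | .crossing _ => 2
  | .vertex _ j => j

/-- A slice: an elementary piece with `left` vertical strands on its left and `right` vertical
strands on its right. -/
structure Slice : Type where
  left : ℕ
  piece : Piece
  right : ℕ

/-- The number of strands at the top of a slice. -/
def Slice.top (s : Slice) : ℕ := s.left + s.piece.top + s.right

/-- The number of strands at the bottom of a slice. -/
def Slice.bot (s : Slice) : ℕ := s.left + s.piece.bot + s.right

/-- Add `a` vertical strands on the left of a slice and `b` on its right. -/
def Slice.widen (a b : ℕ) (s : Slice) : Slice := ⟨a + s.left, s.piece, s.right + b⟩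

/-- `IsPath m w n`: the slices of `w` fit together, from `m` strands at the top to `n` strands at
the bottom. -/
def IsPath (m : ℕ) : List Slice → ℕ → Prop
  | [], n => m = n
  | s :: w, n => s.top = m ∧ IsPath s.bot w n

theorem IsPath.append {m k n : ℕ} {w w' : List Slice} (h : IsPath m w k) (h' : IsPath k w' n) :
    IsPath m (w ++ w') n := by
  induction w generalizing m with
  | nil => simp only [IsPath] at h; subst h; simpa using h'
  | cons s w ih => exact ⟨h.1, ih h.2⟩

theorem IsPath.widen {m n : ℕ} {w : List Slice} (h : IsPath m w n) (a b : ℕ) :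
    IsPath (a + m + b) (w.map (Slice.widen a b)) (a + n + b) := by
  induction w generalizing m with
  | nil => simp only [IsPath] at h; subst h; simp [IsPath]
  | cons s w ih =>
    obtain ⟨h₁, h₂⟩ := h
    refine ⟨by simp only [Slice.top, Slice.widen] at *; omega, ?_⟩
    have e : (Slice.widen a b s).bot = a + s.bot + b := by
      simp only [Slice.bot, Slice.widen]; omega
    simpa only [e] using ih h₂

/-- Diagrams of ribbon graphs with `m` end points on the top line and `n` on the bottom line. -/
@[ext]
structure Diagram (m n : ℕ) : Type where
  word : List Slice
  isPath : IsPath m word n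

namespace Diagram

/-- `m` parallel vertical strands. -/
def id (m : ℕ) : Diagram m m := ⟨[], rfl⟩

/-- Put a diagram on top of another one. -/
def comp {m k n : ℕ} (x : Diagram m k) (y : Diagram k n) : Diagram m n :=
  ⟨x.word ++ y.word, x.isPath.append y.isPath⟩

/-- Add `a` vertical strands on the left and `b` vertical strands on the right. -/
def widen (a b : ℕ) {m n : ℕ} (x : Diagram m n) : Diagram (a + m + b) (a + n + b) :=
  ⟨x.word.map (Slice.widen a b), x.isPath.widen a b⟩

/-- Insert the local diagram `x` in a rectangle: there are `a` strands on its left, `b` strands on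
its right, `u` is above and `v` is below. -/
def insert {m n p q : ℕ} (a b : ℕ) (u : Diagram m (a + p + b)) (v : Diagram (a + q + b) n)
    (x : Diagram p q) : Diagram m n :=
  (u.comp (x.widen a b)).comp v

/-- Diagrams of ribbon `n`-graphs; `x * y` is `x` put over `y`. -/
instance (n : ℕ) : Monoid (Diagram n n) where
  mul := comp
  one := id n
  mul_assoc x y z := Diagram.ext (List.append_assoc _ _ _)
  one_mul x := Diagram.ext (List.nil_append _)
  mul_one x := Diagram.ext (List.append_nil _)

theorem mul_insert {n p q a b : ℕ} (w : Diagram n n) (u : Diagram n (a + p + b))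
    (v : Diagram (a + q + b) n) (x : Diagram p q) :
    w * insert a b u v x = insert a b (w.comp u) v x :=
  Diagram.ext (by change _ ++ ((_ ++ _) ++ _) = ((_ ++ _) ++ _) ++ _; simp [List.append_assoc])

theorem insert_mul {n p q a b : ℕ} (w : Diagram n n) (u : Diagram n (a + p + b))
    (v : Diagram (a + q + b) n) (x : Diagram p q) :
    insert a b u v x * w = insert a b u (v.comp w) x :=
  Diagram.ext (by change ((_ ++ _) ++ _) ++ _ = (_ ++ _) ++ (_ ++ _); simp [List.append_assoc])

end Diagram

/-- The word of the diagram in which the strand that starts at the far left of the top line crosses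
the next `i` strands, one after the other, and ends at the far right of the bottom line. -/
def crossWord (ε : Bool) : ℕ → List Slice
  | 0 => []
  | i + 1 => ⟨0, .crossing ε, i⟩ :: (crossWord ε i).map (Slice.widen 1 0)

theorem isPath_crossWord (ε : Bool) (i : ℕ) : IsPath (1 + i) (crossWord ε i) (i + 1) := by
  induction i with
  | zero => simp [crossWord, IsPath]
  | succ i ih =>
    refine ⟨by simp only [Slice.top, Piece.top]; omega, ?_⟩
    have e : (⟨0, .crossing ε, i⟩ : Slice).bot = 1 + (1 + i) + 0 := by
      simp only [Slice.bot, Piece.bot]; omega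
    have e' : i + 1 + 1 = 1 + (i + 1) + 0 := by omega
    rw [e, e']
    exact ih.widen 1 0

/-! ## Isotopy

Both sides of a move have the same end points; moves are applied inside a rectangle. -/

/-- The moves that generate isotopy of ribbon graphs in terms of diagrams in general position:
planar isotopies and the extended Reidemeister moves. -/
inductive Move : ℕ → ℕ → List Slice → List Slice → Prop
  /-- Planar isotopy: two pieces side by side, with `k` strands between them, change heights. -/
  | exchange (g h : Piece) (k : ℕ) :
      Move (g.top + k + h.top) (g.bot + k + h.bot)
        [⟨0, g, k + h.top⟩, ⟨g.bot + k, h, 0⟩] [⟨g.top + k, h, 0⟩, ⟨0, g, k + h.bot⟩]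
  /-- Planar isotopy: a zigzag is straightened. -/
  | zigzagRight : Move 1 1 [⟨1, .cap, 0⟩, ⟨0, .cup, 1⟩] []
  /-- Planar isotopy: a zigzag is straightened. -/
  | zigzagLeft : Move 1 1 [⟨0, .cap, 1⟩, ⟨1, .cup, 0⟩] []
  /-- Planar isotopy: a crossing slides through a local maximum. -/
  | crossingTurn (ε : Bool) :
      Move 1 3 [⟨0, .cap, 1⟩, ⟨1, .crossing ε, 0⟩] [⟨1, .cap, 0⟩, ⟨0, .crossing (!ε), 1⟩]
  /-- Planar isotopy: the leftmost upper leg of a vertex becomes its leftmost lower leg. -/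
  | vertexTurnLeft (i j : ℕ) :
      Move i (j + 1) [⟨0, .cap, i⟩, ⟨1, .vertex (i + 1) j, 0⟩] [⟨0, .vertex i (j + 1), 0⟩]
  /-- Planar isotopy: the rightmost upper leg of a vertex becomes its rightmost lower leg. -/
  | vertexTurnRight (i j : ℕ) :
      Move i (j + 1) [⟨i, .cap, 0⟩, ⟨0, .vertex (i + 1) j, 1⟩] [⟨0, .vertex i (j + 1), 0⟩]
  /-- First Reidemeister move for ribbons: two curls with opposite twists cancel. -/
  | reidemeisterOne (ε : Bool) :
      Move 1 1 [⟨1, .cap, 0⟩, ⟨0, .crossing ε, 1⟩, ⟨1, .cup, 0⟩,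
        ⟨1, .cap, 0⟩, ⟨0, .crossing (!ε), 1⟩, ⟨1, .cup, 0⟩] []
  /-- Second Reidemeister move. -/
  | reidemeisterTwo (ε : Bool) :
      Move 2 2 [⟨0, .crossing ε, 0⟩, ⟨0, .crossing (!ε), 0⟩] []
  /-- Third Reidemeister move. -/
  | reidemeisterThree (ε : Bool) :
      Move 3 3 [⟨0, .crossing ε, 1⟩, ⟨1, .crossing ε, 0⟩, ⟨0, .crossing ε, 1⟩]
        [⟨1, .crossing ε, 0⟩, ⟨0, .crossing ε, 1⟩, ⟨1, .crossing ε, 0⟩]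
  /-- A strand passes over or under a vertex. -/
  | vertexPass (ε : Bool) (i j : ℕ) :
      Move (1 + i) (j + 1) (crossWord ε i ++ [⟨0, .vertex i j, 1⟩])
        (⟨1, .vertex i j, 0⟩ :: crossWord ε j)

/-- Two diagrams of ribbon `n`-graphs that differ by one move inside a rectangle. -/
def MoveStep {n : ℕ} (x y : Diagram n n) : Prop :=
  ∃ (p q a b : ℕ) (u : Diagram n (a + p + b)) (v : Diagram (a + q + b) n) (s t : Diagram p q),
    Move p q s.word t.word ∧ x = Diagram.insert a b u v s ∧ y = Diagram.insert a b u v t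

/-- Isotopy of ribbon `n`-graphs: the congruence on diagrams generated by the moves. -/
def isotopy (n : ℕ) : Con (Diagram n n) := conGen MoveStep

/-- Ribbon `n`-graphs: diagrams up to isotopy. -/
abbrev RibbonGraph (n : ℕ) : Type := (isotopy n).Quotient

/-- The ribbon `n`-graph of a diagram. -/
def RibbonGraph.ofDiagram {n : ℕ} (x : Diagram n n) : RibbonGraph n := (x : (isotopy n).Quotient)

/-! ## The Yamada skein relations and the algebra `𝒴ₙ` -/

/-- `YamadaRel p q l`: the formal linear combination `∑ c • x`, over the pairs `(c, x)` of the list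
`l`, of diagrams in a rectangle with `p` end points on top and `q` at the bottom, is one of the
expressions that are set to zero. -/
inductive YamadaRel : (p q : ℕ) → List (Coef × List Slice) → Prop
  /-- Crossing: `A⁴` times the vertical smoothing, plus `A⁻⁴` times the horizontal one, minus `d`
  times a four-valent vertex. (The relation for the other crossing is this one, turned by a
  right angle.) -/
  | crossing : YamadaRel 2 2
      [(1, [⟨0, .crossing true, 0⟩]), (-aPow 4, []), (-aPow (-4), [⟨0, .cup, 0⟩, ⟨0, .cap, 0⟩]),
        (d, [⟨0, .vertex 2 2, 0⟩])]
  /-- Deletion-contraction for an edge between two vertices: the contraction of the edge minus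
  `d⁻¹` times its deletion. -/
  | edge (i j : ℕ) : YamadaRel i j
      [(1, [⟨0, .vertex i 1, 0⟩, ⟨0, .vertex 1 j, 0⟩]), (-1, [⟨0, .vertex i j, 0⟩]),
        (dInv, [⟨0, .vertex i 0, 0⟩, ⟨0, .vertex 0 j, 0⟩])]
  /-- A loop that bounds an empty disc at a vertex is deleted with the factor `d - d⁻¹`. -/
  | loop (i : ℕ) : YamadaRel i 0
      [(1, [⟨0, .vertex i 2, 0⟩, ⟨0, .cup, 0⟩]), (-(d - dInv), [⟨0, .vertex i 0, 0⟩])]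
  /-- A circle that bounds an empty disc is deleted with the factor `d² - 1`. -/
  | circle : YamadaRel 0 0
      [(1, [⟨0, .cap, 0⟩, ⟨0, .cup, 0⟩]), (-(d ^ 2 - 1), [])]
  /-- A vertex of valency two is a point on a strand. -/
  | bivalent : YamadaRel 1 1 [(1, [⟨0, .vertex 1 1, 0⟩]), (-1, [])]
  /-- A diagram with a vertex of valency one is zero. -/
  | univalent : YamadaRel 1 0 [(1, [⟨0, .vertex 1 0, 0⟩])]
  /-- An isolated vertex is deleted with the factor `d`. -/
  | isolated : YamadaRel 0 0 [(1, [⟨0, .vertex 0 0, 0⟩]), (-d, [])]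

/-- The free `𝓡`-module on the ribbon `n`-graphs, with the product of ribbon `n`-graphs extended
bilinearly. -/
abbrev FreeY (n : ℕ) : Type := MonoidAlgebra Coef (RibbonGraph n)

/-- The linear combination `∑ c • x` over the pairs `(c, x)` of a list, in the free module. -/
noncomputable def linComb {n : ℕ} (l : List (Coef × Diagram n n)) : FreeY n :=
  (l.map fun t => MonoidAlgebra.single (RibbonGraph.ofDiagram t.2) t.1).sum

/-- The expressions of the Yamada relations in the free module: linear combinations of diagrams
that are identical outside of a rectangle, in which they look as in one of the relations. -/
noncomputable def skeinExpr (n : ℕ) : Set (FreeY n) :=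
  {z | ∃ (p q a b : ℕ) (u : Diagram n (a + p + b)) (v : Diagram (a + q + b) n)
    (l : List (Coef × Diagram p q)), YamadaRel p q (l.map fun t => (t.1, t.2.word)) ∧
      z = linComb (l.map fun t => (t.1, Diagram.insert a b u v t.2))}

/-- The smallest submodule that contains all expressions of the Yamada relations. -/
noncomputable def skeinSubmodule (n : ℕ) : Submodule Coef (FreeY n) := Submodule.span Coef (skeinExpr n)

theorem single_mul_linComb {n : ℕ} (w : Diagram n n) (c : Coef) (l : List (Coef × Diagram n n)) :
    MonoidAlgebra.single (RibbonGraph.ofDiagram w) c * linComb l =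
      c • linComb (l.map fun t => (t.1, w * t.2)) := by
  induction l with
  | nil => simp [linComb]
  | cons t l ih =>
    simp only [linComb, List.map_cons, List.sum_cons, mul_add, smul_add] at ih ⊢
    rw [ih, MonoidAlgebra.single_mul_single, MonoidAlgebra.smul_single]
    rfl

theorem linComb_mul_single {n : ℕ} (w : Diagram n n) (c : Coef) (l : List (Coef × Diagram n n)) :
    linComb l * MonoidAlgebra.single (RibbonGraph.ofDiagram w) c =
      c • linComb (l.map fun t => (t.1, t.2 * w)) := by
  induction l with
  | nil => simp [linComb]
  | cons t l ih =>
    simp only [linComb, List.map_cons, List.sum_cons, add_mul, smul_add] at ih ⊢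
    rw [ih, MonoidAlgebra.single_mul_single, MonoidAlgebra.smul_single, mul_comm t.1 c]
    rfl

theorem mul_mem_skeinSubmodule {n : ℕ} (y : FreeY n) {x : FreeY n} (hx : x ∈ skeinSubmodule n) :
    y * x ∈ skeinSubmodule n := by
  induction hx using Submodule.span_induction with
  | zero => simp
  | add x x' _ _ h h' => rw [mul_add]; exact add_mem h h'
  | smul c x _ h => rw [mul_smul_comm]; exact Submodule.smul_mem _ _ h
  | mem x hx =>
    obtain ⟨p, q, a, b, u, v, l, hl, rfl⟩ := hx
    induction y using MonoidAlgebra.induction_linear with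
    | zero => simp
    | add y y' h h' => rw [add_mul]; exact add_mem h h'
    | single g c =>
      induction g using Con.induction_on with
      | H w =>
        have e := single_mul_linComb w c (l.map fun t => (t.1, Diagram.insert a b u v t.2))
        refine e ▸ Submodule.smul_mem _ _ (Submodule.subset_span
          ⟨p, q, a, b, w.comp u, v, l, hl, ?_⟩)
        simp only [List.map_map, Function.comp_def, Diagram.mul_insert]

theorem mem_mul_skeinSubmodule {n : ℕ} (y : FreeY n) {x : FreeY n} (hx : x ∈ skeinSubmodule n) :
    x * y ∈ skeinSubmodule n := by
  induction hx using Submodule.span_induction with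
  | zero => simp
  | add x x' _ _ h h' => rw [add_mul]; exact add_mem h h'
  | smul c x _ h => rw [smul_mul_assoc]; exact Submodule.smul_mem _ _ h
  | mem x hx =>
    obtain ⟨p, q, a, b, u, v, l, hl, rfl⟩ := hx
    induction y using MonoidAlgebra.induction_linear with
    | zero => simp
    | add y y' h h' => rw [mul_add]; exact add_mem h h'
    | single g c =>
      induction g using Con.induction_on with
      | H w =>
        have e := linComb_mul_single w c (l.map fun t => (t.1, Diagram.insert a b u v t.2))
        refine e ▸ Submodule.smul_mem _ _ (Submodule.subset_span
          ⟨p, q, a, b, u, v.comp w, l, hl, ?_⟩)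
        simp only [List.map_map, Function.comp_def, Diagram.insert_mul]

/-- The skein submodule, which is a two-sided ideal of the free module with its product. -/
noncomputable def skeinIdeal (n : ℕ) : Ideal (FreeY n) where
  carrier := skeinSubmodule n
  add_mem' := add_mem
  zero_mem' := zero_mem _
  smul_mem' y _ hx := mul_mem_skeinSubmodule y hx

instance (n : ℕ) : (skeinIdeal n).IsTwoSided := ⟨fun y hx => mem_mul_skeinSubmodule y hx⟩

/-- The graph algebra `𝒴ₙ`: the free `𝓡`-module on the ribbon `n`-graphs modulo the Yamada
relations, with the product induced by putting a ribbon `n`-graph over another one. -/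
abbrev Y (n : ℕ) : Type := FreeY n ⧸ skeinIdeal n

/-- The class in `𝒴ₙ` of a diagram. -/
noncomputable def Y.ofDiagram {n : ℕ} (x : Diagram n n) : Y n :=
  Ideal.Quotient.mk (skeinIdeal n) (MonoidAlgebra.single (RibbonGraph.ofDiagram x) 1)

/-! ## The six elements of `𝒴₃` -/

/-- `A`: three parallel vertical strands. -/
def diagramA : Diagram 3 3 := Diagram.id 3

/-- `B`: a cup on the top points `1, 2`, a cap on the bottom points `1, 2`, and a vertical third
strand. -/
def diagramB : Diagram 3 3 :=
  ⟨[⟨0, .cup, 1⟩, ⟨0, .cap, 1⟩], by simp [IsPath, Slice.top, Slice.bot, Piece.top, Piece.bot]⟩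

/-- `C`: a vertical first strand, a cup on the top points `2, 3` and a cap on the bottom points
`2, 3`. -/
def diagramC : Diagram 3 3 :=
  ⟨[⟨1, .cup, 0⟩, ⟨1, .cap, 0⟩], by simp [IsPath, Slice.top, Slice.bot, Piece.top, Piece.bot]⟩

/-- `F`: a vertical first strand and a vertex joined to the top points `2, 3` and to the bottom
points `2, 3`. -/
def diagramF : Diagram 3 3 :=
  ⟨[⟨1, .vertex 2 2, 0⟩], by simp [IsPath, Slice.top, Slice.bot, Piece.top, Piece.bot]⟩

/-- `G`: a vertex joined to the top points `1, 2` and to the bottom points `1, 2`, and a vertical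
third strand. -/
def diagramG : Diagram 3 3 :=
  ⟨[⟨0, .vertex 2 2, 1⟩], by simp [IsPath, Slice.top, Slice.bot, Piece.top, Piece.bot]⟩

/-- `N`: a vertex joined to all six boundary points. -/
def diagramN : Diagram 3 3 :=
  ⟨[⟨0, .vertex 3 3, 0⟩], by simp [IsPath, Slice.top, Slice.bot, Piece.top, Piece.bot]⟩

end RibbonSkein

namespace RibbonSkein

/-! Bend the top points of a ribbon `3`-graph down to its left end: the graph becomes a diagram with
six lower end points beside three vertical strands, and `bendCups` undoes the bending. A bent
diagram is absorbed slice by slice into disjoint stars, that is, vertices all of whose legs go down.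
A cap is a bivalent star; a vertex with upper legs is a star followed by cups; a crossing is
expanded by its Yamada relation. A cup either closes a loop on one star, which the loop relation
deletes, or joins two stars, and then the edge relation contracts or deletes their common edge. This
is the content of `Stars.vertex_one_mem`, `Stars.cup_mem` and `Reduces.append`.

Stars of valency zero give a factor `d` and stars of valency one give zero, so what is left are the
noncrossing partitions of six points into blocks of size at least two. There are fifteen: one block
of six is `N`; the six of type 4+2 are `F`, `G`, `BF`, `FB`, `CG`, `GC`; the five of type 2+2+2 are
`1`, `B`, `C`, `BC`, `CB`. The three of type 3+3 are the deletion terms of the edge relation for an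
edge in `FG`, `GF` and `GCBF`, whose contraction is `N` each time. They are generated because the
coefficient of the deletion term is a unit.

Relations are stated through `val`, as identities valid under every prefix, so that they can be
turned by putting caps over them. The planar isotopies between explicit diagrams are left to the
algorithm `straighten`. -/

/-! ### Classes of words and local relations in context -/

theorem IsPath.unique {m k k' : ℕ} {w : List Slice} (h : IsPath m w k) (h' : IsPath m w k') :
    k = k' := by
  induction w generalizing m with
  | nil => exact h.symm.trans h'
  | cons s w ih => exact ih h.2 h'.2

theorem IsPath.of_append {m n : ℕ} {u w : List Slice} (h : IsPath m (u ++ w) n) :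
    ∃ k, IsPath m u k ∧ IsPath k w n := by
  induction u generalizing m with
  | nil => exact ⟨m, rfl, h⟩
  | cons s u ih =>
    obtain ⟨k, hk, hk'⟩ := ih h.2
    exact ⟨k, ⟨h.1, hk⟩, hk'⟩

theorem IsPath.append_iff {m k n : ℕ} {u w : List Slice} (h : IsPath m u k) :
    IsPath m (u ++ w) n ↔ IsPath k w n := by
  refine ⟨fun h' => ?_, h.append⟩
  obtain ⟨k', hk, hk'⟩ := h'.of_append
  rwa [h.unique hk]

theorem IsPath.snoc {m k k' : ℕ} {u : List Slice} (h : IsPath m u k) {s : Slice}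
    (hs : s.top = k) (hs' : s.bot = k') : IsPath m (u ++ [s]) k' :=
  h.append ⟨hs, hs'⟩

open Classical in
/-- The class in `𝒴ₙ` of the diagram with a given word; it is zero if the slices do not fit. -/
noncomputable def ev (n : ℕ) (w : List Slice) : Y n :=
  if h : IsPath n w n then Y.ofDiagram ⟨w, h⟩ else 0

theorem ev_of_isPath {n : ℕ} {w : List Slice} (h : IsPath n w n) :
    ev n w = Y.ofDiagram ⟨w, h⟩ := dif_pos h

theorem ev_of_not_isPath {n : ℕ} {w : List Slice} (h : ¬ IsPath n w n) : ev n w = 0 := dif_neg h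

theorem ev_word {n : ℕ} (x : Diagram n n) : ev n x.word = Y.ofDiagram x := ev_of_isPath x.isPath

theorem ofDiagram_mul {n : ℕ} (x y : Diagram n n) :
    Y.ofDiagram (x * y) = Y.ofDiagram x * Y.ofDiagram y := by
  unfold Y.ofDiagram
  rw [← map_mul, MonoidAlgebra.single_mul_single, mul_one]
  rfl

theorem mk_linComb {n : ℕ} (l : List (Coef × Diagram n n)) :
    Ideal.Quotient.mk (skeinIdeal n) (linComb l) = 
      (l.map fun t => (t.1 • Y.ofDiagram t.2 : Y n)).sum := by
  induction l with
  | nil => simp [linComb]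
  | cons t l ih =>
    simp only [linComb, List.map_cons, List.sum_cons, map_add] at ih ⊢
    rw [ih]
    have e : MonoidAlgebra.single (RibbonGraph.ofDiagram t.2) t.1 =
        t.1 • (MonoidAlgebra.single (RibbonGraph.ofDiagram t.2) 1 : FreeY n) := by
      rw [MonoidAlgebra.smul_single, smul_eq_mul, mul_one]
    rw [e]
    rfl

/-- The word `v` below the move is arbitrary: the two sides of a move have the same end points, so
either both words are diagrams or both have the default value zero. -/
theorem ev_move {n p q a b : ℕ} {s t u : List Slice} (v : List Slice) (h : Move p q s t)
    (hs : IsPath p s q) (ht : IsPath p t q) (hu : IsPath n u (a + p + b)) :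
    ev n (u ++ (s.map (Slice.widen a b) ++ v)) = ev n (u ++ (t.map (Slice.widen a b) ++ v)) := by
  have key : ∀ w, IsPath p w q →
      (IsPath n (u ++ (w.map (Slice.widen a b) ++ v)) n ↔ IsPath (a + q + b) v n) :=
    fun w hw => hu.append_iff.trans (hw.widen a b).append_iff
  by_cases hv : IsPath (a + q + b) v n
  · rw [ev_of_isPath ((key s hs).2 hv), ev_of_isPath ((key t ht).2 hv)]
    have e : MoveStep (⟨_, (key s hs).2 hv⟩ : Diagram n n) ⟨_, (key t ht).2 hv⟩ := by
      refine ⟨p, q, a, b, ⟨u, hu⟩, ⟨v, hv⟩, ⟨s, hs⟩, ⟨t, ht⟩, h, ?_, ?_⟩ <;>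
      · apply Diagram.ext
        simp [Diagram.insert, Diagram.comp, Diagram.widen]
    have e' := (Con.eq (isotopy n)).2 (ConGen.Rel.of _ _ e)
    unfold Y.ofDiagram RibbonGraph.ofDiagram
    rw [e']
  · rw [ev_of_not_isPath (mt (key s hs).1 hv), ev_of_not_isPath (mt (key t ht).1 hv)]

theorem sum_smul_ev_eq_zero {n p q a b : ℕ} {u : List Slice} (v : List Slice)
    (l : List (Coef × Diagram p q)) (hl : YamadaRel p q (l.map fun t => (t.1, t.2.word)))
    (hu : IsPath n u (a + p + b)) :
    (l.map fun t => (t.1 • ev n (u ++ (t.2.word.map (Slice.widen a b) ++ v)) : Y n)).sum = 0 := by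
  have key : ∀ w, IsPath p w q →
      (IsPath n (u ++ (w.map (Slice.widen a b) ++ v)) n ↔ IsPath (a + q + b) v n) :=
    fun w hw => hu.append_iff.trans (hw.widen a b).append_iff
  by_cases hv : IsPath (a + q + b) v n
  · have e : linComb (l.map fun t => (t.1, Diagram.insert a b ⟨u, hu⟩ ⟨v, hv⟩ t.2)) ∈ skeinExpr n :=
      ⟨p, q, a, b, ⟨u, hu⟩, ⟨v, hv⟩, l, hl, rfl⟩
    have e' : Ideal.Quotient.mk (skeinIdeal n) _ = 0 :=
      Ideal.Quotient.eq_zero_iff_mem.2 (Submodule.subset_span e)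
    rw [mk_linComb, List.map_map] at e'
    rw [← e']
    congr 1
    refine List.map_congr_left fun t _ => ?_
    rw [ev_of_isPath ((key _ t.2.isPath).2 hv)]
    simp only [Function.comp]
    congr 2
    apply Diagram.ext
    simp [Diagram.insert, Diagram.comp, Diagram.widen]
  · rw [List.sum_eq_zero]
    intro x hx
    obtain ⟨t, -, rfl⟩ := List.mem_map.1 hx
    rw [ev_of_not_isPath (mt (key _ t.2.isPath).1 hv), smul_zero]

/-! ## Words under a prefix -/

/-- The value of a word that starts with `m` strands, as a function of what is put over it. Linear
relations between such functions are the relations that hold below every diagram. -/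
noncomputable def val (n m : ℕ) (w : List Slice) : {u : List Slice // IsPath n u m} → Y n :=
  fun u => ev n (u.1 ++ w)

/-- Put a slice on top. -/
noncomputable def consMap (n : ℕ) {m k : ℕ} (s : Slice) (h : s.top = m) (h' : s.bot = k) :
    ({u : List Slice // IsPath n u k} → Y n) →ₗ[Coef] ({u : List Slice // IsPath n u m} → Y n) :=
  LinearMap.funLeft Coef (Y n) fun u => ⟨u.1 ++ [s], u.2.snoc h h'⟩

@[simp]
theorem consMap_val {n m k : ℕ} (s : Slice) (h : s.top = m) (h' : s.bot = k) (w : List Slice) :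
    consMap n s h h' (val n k w) = val n m (s :: w) := by
  funext u
  simp [consMap, LinearMap.funLeft, val]

/-- This is what allows a rewrite below the first slice of a word, since agreement under every
prefix survives lengthening the prefix. -/
theorem val_cons_congr {n m k : ℕ} {s : Slice} (h : s.top = m) (h' : s.bot = k)
    {w w' : List Slice} (e : val n k w = val n k w') : val n m (s :: w) = val n m (s :: w') := by
  simpa using congrArg (consMap n s h h') e

theorem val_move {n m p q : ℕ} (a b : ℕ) {s t : List Slice} (h : Move p q s t)
    (hs : IsPath p s q) (ht : IsPath p t q) (hm : m = a + p + b) (v : List Slice) :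
    val n m (s.map (Slice.widen a b) ++ v) = val n m (t.map (Slice.widen a b) ++ v) := by
  subst hm
  funext u
  exact ev_move v h hs ht u.2

theorem sum_smul_val_eq_zero {n m p q : ℕ} (a b : ℕ) (l : List (Coef × Diagram p q))
    (hl : YamadaRel p q (l.map fun t => (t.1, t.2.word))) (hm : m = a + p + b) (v : List Slice) :
    (l.map fun t => t.1 • val n m (t.2.word.map (Slice.widen a b) ++ v)).sum = 0 := by
  subst hm
  funext u
  rw [Pi.zero_apply, ← sum_smul_ev_eq_zero v l hl u.2]
  clear hl
  induction l with
  | nil => rfl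
  | cons t l ih => simp [ih, val]

/-! ## Planar isotopies at an arbitrary place -/

theorem val_exchange {n m : ℕ} (g h : Piece) (l k r : ℕ) {l₁ l₂ r₁ r₂ : ℕ} (w : List Slice)
    (hm : m = l + g.top + k + h.top + r := by simp only [Slice.bot, Piece.top, Piece.bot] <;> omega)
    (h₁ : r₁ = k + h.top + r := by simp only [Piece.top] <;> omega)
    (h₂ : l₁ = l + g.bot + k := by simp only [Piece.bot] <;> omega)
    (h₃ : l₂ = l + g.top + k := by simp only [Piece.top] <;> omega)
    (h₄ : r₂ = k + h.bot + r := by simp only [Piece.bot] <;> omega) :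
    val n m (⟨l, g, r₁⟩ :: ⟨l₁, h, r⟩ :: w) = val n m (⟨l₂, h, r⟩ :: ⟨l, g, r₂⟩ :: w) := by
  subst h₁ h₂ h₃ h₄
  have := val_move (n := n) (m := m) l r (Move.exchange g h k)
    (by simp only [IsPath, Slice.top, Slice.bot]; omega)
    (by simp only [IsPath, Slice.top, Slice.bot]; omega) (by omega) w
  simpa [Slice.widen, Nat.add_assoc] using this

theorem val_cap_cup_right {n m : ℕ} (l r : ℕ) (w : List Slice) (hm : m = l + 1 + r := by omega) :
    val n m (⟨l + 1, .cap, r⟩ :: ⟨l, .cup, r + 1⟩ :: w) = val n m w := by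
  have := val_move (n := n) (m := m) l r Move.zigzagRight
    (by simp [IsPath, Slice.top, Slice.bot, Piece.top, Piece.bot]) rfl hm w
  simpa [Slice.widen, Nat.add_comm] using this

theorem val_cap_cup_left {n m : ℕ} (l r : ℕ) (w : List Slice) (hm : m = l + 1 + r := by omega) :
    val n m (⟨l, .cap, r + 1⟩ :: ⟨l + 1, .cup, r⟩ :: w) = val n m w := by
  have := val_move (n := n) (m := m) l r Move.zigzagLeft
    (by simp [IsPath, Slice.top, Slice.bot, Piece.top, Piece.bot]) rfl hm w
  simpa [Slice.widen, Nat.add_comm] using this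

theorem val_cap_crossing {n m : ℕ} (ε : Bool) (l r : ℕ) (w : List Slice)
    (hm : m = l + 1 + r := by omega) :
    val n m (⟨l, .cap, r + 1⟩ :: ⟨l + 1, .crossing ε, r⟩ :: w) =
      val n m (⟨l + 1, .cap, r⟩ :: ⟨l, .crossing (!ε), r + 1⟩ :: w) := by
  have := val_move (n := n) (m := m) l r (Move.crossingTurn ε)
    (by simp [IsPath, Slice.top, Slice.bot, Piece.top, Piece.bot])
    (by simp [IsPath, Slice.top, Slice.bot, Piece.top, Piece.bot]) hm w
  simpa [Slice.widen, Nat.add_comm] using this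

theorem val_cap_vertex_left {n m : ℕ} (i j l r : ℕ) {r' : ℕ} (w : List Slice)
    (hm : m = l + i + r := by omega) (hr : r' = i + r := by omega) :
    val n m (⟨l, .cap, r'⟩ :: ⟨l + 1, .vertex (i + 1) j, r⟩ :: w) =
      val n m (⟨l, .vertex i (j + 1), r⟩ :: w) := by
  subst hr
  have := val_move (n := n) (m := m) l r (Move.vertexTurnLeft i j)
    (by simp only [IsPath, Slice.top, Slice.bot, Piece.top, Piece.bot]; omega)
    (by simp only [IsPath, Slice.top, Slice.bot, Piece.top, Piece.bot]; omega) hm w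
  simpa [Slice.widen] using this

theorem val_cap_vertex_right {n m : ℕ} (i j l r : ℕ) {l' : ℕ} (w : List Slice)
    (hm : m = l + i + r := by omega) (hl : l' = l + i := by omega) :
    val n m (⟨l', .cap, r⟩ :: ⟨l, .vertex (i + 1) j, r + 1⟩ :: w) =
      val n m (⟨l, .vertex i (j + 1), r⟩ :: w) := by
  subst hl
  have := val_move (n := n) (m := m) l r (Move.vertexTurnRight i j)
    (by simp only [IsPath, Slice.top, Slice.bot, Piece.top, Piece.bot]; omega)
    (by simp only [IsPath, Slice.top, Slice.bot, Piece.top, Piece.bot]; omega) hm w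
  simpa [Slice.widen, Nat.add_comm 1] using this

/-- A cup that joins the rightmost lower leg of a vertex with a strand on its right. -/
theorem val_vertex_cup_right {n m : ℕ} (i j l r : ℕ) {l' : ℕ} (w : List Slice)
    (hm : m = l + i + 1 + r := by omega) (hl : l' = l + j := by omega) :
    val n m (⟨l, .vertex i (j + 1), r + 1⟩ :: ⟨l', .cup, r⟩ :: w) =
      val n m (⟨l, .vertex (i + 1) j, r⟩ :: w) := by
  subst hl
  -- The last lower leg is written as an upper leg led over a cap. Once the vertex has slid below
  -- the cup, cap and cup form a zigzag.
  rw [← val_cap_vertex_right i j l (r + 1) _ (by omega) rfl, val_cons_congr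
    (by simp only [Slice.top, Piece.top]; omega) rfl
    (val_exchange (.vertex (i + 1) j) .cup l 0 r (l₂ := l + i + 1) (r₂ := r) w),
    val_cap_cup_left (l + i) r _]

/-- A cup that joins the leftmost lower leg of a vertex with a strand on its left. -/
theorem val_vertex_cup_left {n m : ℕ} (i j l r : ℕ) {r' : ℕ} (w : List Slice)
    (hm : m = l + 1 + i + r := by omega) (hr : r' = j + r := by omega) :
    val n m (⟨l + 1, .vertex i (j + 1), r⟩ :: ⟨l, .cup, r'⟩ :: w) =
      val n m (⟨l, .vertex (i + 1) j, r⟩ :: w) := by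
  subst hr
  rw [← val_cap_vertex_left i j (l + 1) r _ hm rfl, val_cons_congr
    (by simp only [Slice.top, Piece.top]; omega) rfl
    (val_exchange .cup (.vertex (i + 1) j) l 0 r (l₁ := l) (r₁ := i + r + 1) (l₂ := l + 1 + 1)
      (r₂ := j + r) w).symm,
    val_cap_cup_right l (i + r) _]

/-- The skein relation is given only for `crossing true`. Turning by a right angle exchanges the two
kinds of crossing, so this identity carries the relation over to the other kind. -/
theorem val_crossing_false {n m : ℕ} (l r : ℕ) (w : List Slice) (hm : m = l + 2 + r := by omega) :
    val n m (⟨l, .crossing false, r⟩ :: w) =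
      val n m (⟨l, .cap, r + 2⟩ :: ⟨l + 1, .crossing true, r + 1⟩ :: ⟨l + 2, .cup, r⟩ :: w) := by
  rw [val_cap_crossing true l (r + 1) _, Bool.not_true, val_cons_congr
    (by simp only [Slice.top, Piece.top]; omega) rfl
    (val_exchange (.crossing false) .cup l 0 r (l₂ := l + 2) (r₂ := r) w),
    val_cap_cup_left (l + 1) r _]

/-! ## The Yamada relations at an arbitrary place -/

theorem val_crossing_true {n m : ℕ} (l r : ℕ) (w : List Slice) (hm : m = l + 2 + r := by omega) :
    val n m (⟨l, .crossing true, r⟩ :: w) = aPow 4 • val n m w +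
      aPow (-4) • val n m (⟨l, .cup, r⟩ :: ⟨l, .cap, r⟩ :: w) -
      d • val n m (⟨l, .vertex 2 2, r⟩ :: w) := by
  have := sum_smul_val_eq_zero (n := n) (m := m) (p := 2) (q := 2) l r
    [(1, ⟨[⟨0, .crossing true, 0⟩], ⟨rfl, rfl⟩⟩), (-aPow 4, ⟨[], rfl⟩),
      (-aPow (-4), ⟨[⟨0, .cup, 0⟩, ⟨0, .cap, 0⟩], ⟨rfl, rfl, rfl⟩⟩),
        (d, ⟨[⟨0, .vertex 2 2, 0⟩], ⟨rfl, rfl⟩⟩)] YamadaRel.crossing hm w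
  simp only [List.map_cons, List.map_nil, List.sum_cons, List.sum_nil, Slice.widen,
    List.cons_append, List.nil_append, Nat.add_zero, Nat.zero_add, one_smul, neg_smul] at this
  rw [← sub_eq_zero, ← this]
  abel

theorem val_vertex_vertex {n m : ℕ} (i j l r : ℕ) (w : List Slice)
    (hm : m = l + i + r := by omega) :
    val n m (⟨l, .vertex i 1, r⟩ :: ⟨l, .vertex 1 j, r⟩ :: w) =
      val n m (⟨l, .vertex i j, r⟩ :: w) -
        dInv • val n m (⟨l, .vertex i 0, r⟩ :: ⟨l, .vertex 0 j, r⟩ :: w) := by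
  have := sum_smul_val_eq_zero (n := n) (m := m) (p := i) (q := j) l r
    [(1, ⟨[⟨0, .vertex i 1, 0⟩, ⟨0, .vertex 1 j, 0⟩],
        by simp [IsPath, Slice.top, Slice.bot, Piece.top, Piece.bot]⟩),
      (-1, ⟨[⟨0, .vertex i j, 0⟩],
        by simp [IsPath, Slice.top, Slice.bot, Piece.top, Piece.bot]⟩),
      (dInv, ⟨[⟨0, .vertex i 0, 0⟩, ⟨0, .vertex 0 j, 0⟩],
        by simp [IsPath, Slice.top, Slice.bot, Piece.top, Piece.bot]⟩)] (YamadaRel.edge i j) hm w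
  simp only [List.map_cons, List.map_nil, List.sum_cons, List.sum_nil, Slice.widen,
    List.cons_append, List.nil_append, Nat.add_zero, Nat.zero_add, one_smul, neg_smul] at this
  rw [← sub_eq_zero, ← this]
  abel

theorem val_vertex_loop {n m : ℕ} (i l r : ℕ) (w : List Slice) (hm : m = l + i + r := by omega) :
    val n m (⟨l, .vertex i 2, r⟩ :: ⟨l, .cup, r⟩ :: w) =
      (d - dInv) • val n m (⟨l, .vertex i 0, r⟩ :: w) := by
  have := sum_smul_val_eq_zero (n := n) (m := m) (p := i) (q := 0) l r
    [(1, ⟨[⟨0, .vertex i 2, 0⟩, ⟨0, .cup, 0⟩],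
        by simp [IsPath, Slice.top, Slice.bot, Piece.top, Piece.bot]⟩),
      (-(d - dInv), ⟨[⟨0, .vertex i 0, 0⟩],
        by simp [IsPath, Slice.top, Slice.bot, Piece.top, Piece.bot]⟩)] (YamadaRel.loop i) hm w
  simp only [List.map_cons, List.map_nil, List.sum_cons, List.sum_nil, Slice.widen,
    List.cons_append, List.nil_append, Nat.add_zero, Nat.zero_add, one_smul, neg_smul] at this
  rw [← sub_eq_zero, ← this]
  abel

theorem val_vertex_one_one {n m : ℕ} (l r : ℕ) (w : List Slice) (hm : m = l + 1 + r := by omega) :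
    val n m (⟨l, .vertex 1 1, r⟩ :: w) = val n m w := by
  have := sum_smul_val_eq_zero (n := n) (m := m) (p := 1) (q := 1) l r
    [(1, ⟨[⟨0, .vertex 1 1, 0⟩], ⟨rfl, rfl⟩⟩), (-1, ⟨[], rfl⟩)] YamadaRel.bivalent hm w
  simp only [List.map_cons, List.map_nil, List.sum_cons, List.sum_nil, Slice.widen,
    List.cons_append, List.nil_append, Nat.add_zero, Nat.zero_add, one_smul, neg_smul] at this
  rw [← sub_eq_zero, ← this]
  abel

theorem val_vertex_one_zero {n m : ℕ} (l r : ℕ) (w : List Slice)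
    (hm : m = l + 1 + r := by omega) : val n m (⟨l, .vertex 1 0, r⟩ :: w) = 0 := by
  have := sum_smul_val_eq_zero (n := n) (m := m) (p := 1) (q := 0) l r
    [(1, ⟨[⟨0, .vertex 1 0, 0⟩], ⟨rfl, rfl⟩⟩)] YamadaRel.univalent hm w
  simpa [Slice.widen] using this

theorem val_vertex_zero_zero {n m : ℕ} (l r : ℕ) (w : List Slice) (hm : m = l + r := by omega) :
    val n m (⟨l, .vertex 0 0, r⟩ :: w) = d • val n m w := by
  have := sum_smul_val_eq_zero (n := n) (m := m) (p := 0) (q := 0) l r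
    [(1, ⟨[⟨0, .vertex 0 0, 0⟩], ⟨rfl, rfl⟩⟩), (-d, ⟨[], rfl⟩)] YamadaRel.isolated hm w
  simp only [List.map_cons, List.map_nil, List.sum_cons, List.sum_nil, Slice.widen,
    List.cons_append, List.nil_append, Nat.add_zero, Nat.zero_add, one_smul, neg_smul] at this
  rw [← sub_eq_zero, ← this]
  abel

/-- A cap over the relation for a univalent vertex turns its leg downwards. -/
theorem val_vertex_zero_one {n m : ℕ} (l r : ℕ) (w : List Slice) (hm : m = l + r := by omega) :
    val n m (⟨l, .vertex 0 1, r⟩ :: w) = 0 := by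
  have e := congrArg (consMap n (m := m) ⟨l, .cap, r⟩
    (by simp only [Slice.top, Piece.top]; omega) rfl)
    (val_vertex_one_zero (n := n) (l + 1) r w (by simp only [Slice.bot, Piece.bot]))
  rwa [consMap_val, map_zero, val_cap_vertex_left 0 0 l r w] at e

/-- A bivalent vertex is inserted on the strand of the cap and its upper leg is turned down, so a
cap counts as a star with two legs. -/
theorem val_cap {n m : ℕ} (l r : ℕ) (w : List Slice) (hm : m = l + r := by omega) :
    val n m (⟨l, .cap, r⟩ :: w) = val n m (⟨l, .vertex 0 2, r⟩ :: w) := by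
  rw [← val_cap_vertex_left 0 1 l r w (hr := (Nat.zero_add r).symm)]
  exact (val_cons_congr (by simp only [Slice.top, Piece.top]; omega) rfl (val_vertex_one_one _ _ _
    (by simp only [Slice.bot, Piece.bot]))).symm

/-- Contraction of the edge that joins the lower leg number `p` of a vertex with another vertex. -/
theorem val_contract {n m : ℕ} (k : ℕ) (w : List Slice) (p q i l r : ℕ) {j j₁ j₂ l' r' : ℕ}
    (hm : m = l + i + r := by omega) (hj : j = p + 1 + q := by omega) (hl : l' = l + p := by omega)
    (hr : r' = q + r := by omega) (hj₁ : j₁ = p + k + q := by omega)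
    (hj₂ : j₂ = p + q := by omega) :
    val n m (⟨l, .vertex i j, r⟩ :: ⟨l', .vertex 1 k, r'⟩ :: w) =
      val n m (⟨l, .vertex i j₁, r⟩ :: w) -
        dInv • val n m (⟨l, .vertex i j₂, r⟩ :: ⟨l', .vertex 0 k, r'⟩ :: w) := by
  induction p generalizing i l m j j₁ j₂ with
  | succ p ih =>
    obtain rfl : j = p + 1 + q + 1 := by omega
    obtain rfl : j₁ = p + k + q + 1 := by omega
    obtain rfl : j₂ = p + q + 1 := by omega
    -- A cap over the whole relation turns the leftmost upper leg of the vertex into its leftmost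
    -- lower leg, in all terms at once. This supplies the additional leg on the left; for `q` the
    -- same is done on the right.
    have e := congrArg (consMap n (m := m) ⟨l, .cap, i + r⟩
      (by simp only [Slice.top, Piece.top]; omega) rfl)
      (ih (i + 1) (l + 1) (by simp only [Slice.bot, Piece.bot]; omega) rfl (by omega) rfl rfl)
    simpa only [map_sub, map_smul, consMap_val, val_cap_vertex_left i _ l r _ hm rfl] using e
  | zero =>
    induction q generalizing i r m j j₁ j₂ with
    | zero =>
      obtain rfl : l = l' := by omega
      subst hj hj₁ hj₂ hr
      simpa using val_vertex_vertex i k l r w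
    | succ q ih =>
      obtain rfl : j = q + 1 + 1 := by omega
      obtain rfl : j₁ = k + q + 1 := by omega
      obtain rfl : j₂ = q + 1 := by omega
      have h₁ : (⟨l + i, .cap, r⟩ : Slice).top = m := by simp only [Slice.top, Piece.top]; omega
      have h₂ : (⟨l + i, .cap, r⟩ : Slice).bot = l + i + 2 + r := rfl
      have e := congrArg (consMap n _ h₁ h₂)
        (ih (i := i + 1) (r := r + 1) (m := l + i + 2 + r)
          (hm := by omega) (hr := by omega) (hj := rfl) (hj₁ := rfl) (hj₂ := rfl))
      simp only [map_sub, map_smul, consMap_val, val_cap_vertex_right i _ l r _ hm rfl] at e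
      simpa only [Nat.zero_add, Nat.add_comm 1] using e

/-- A loop at two neighbouring lower legs of a vertex. -/
theorem val_loop {n m : ℕ} (w : List Slice) (p q i l r : ℕ) {j j' l' r' : ℕ}
    (hm : m = l + i + r := by omega) (hj : j = p + 2 + q := by omega) (hl : l' = l + p := by omega)
    (hr : r' = q + r := by omega) (hj' : j' = p + q := by omega) :
    val n m (⟨l, .vertex i j, r⟩ :: ⟨l', .cup, r'⟩ :: w) =
      (d - dInv) • val n m (⟨l, .vertex i j', r⟩ :: w) := by
  induction p generalizing i l m j j' with
  | succ p ih =>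
    obtain rfl : j = p + 2 + q + 1 := by omega
    obtain rfl : j' = p + q + 1 := by omega
    have e := congrArg (consMap n (m := m) ⟨l, .cap, i + r⟩
      (by simp only [Slice.top, Piece.top]; omega) rfl)
      (ih (i + 1) (l + 1) (by simp only [Slice.bot, Piece.bot]; omega) rfl (by omega) rfl)
    simpa only [map_smul, consMap_val, val_cap_vertex_left i _ l r _ hm rfl] using e
  | zero =>
    induction q generalizing i r m j j' with
    | zero =>
      obtain rfl : l = l' := by omega
      subst hj hj' hr
      simpa using val_vertex_loop i l r w
    | succ q ih =>
      obtain rfl : j = q + 2 + 1 := by omega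
      obtain rfl : j' = q + 1 := by omega
      have h₁ : (⟨l + i, .cap, r⟩ : Slice).top = m := by simp only [Slice.top, Piece.top]; omega
      have h₂ : (⟨l + i, .cap, r⟩ : Slice).bot = l + i + 2 + r := rfl
      have e := congrArg (consMap n _ h₁ h₂)
        (ih (i := i + 1) (r := r + 1) (m := l + i + 2 + r)
          (hm := by omega) (hr := by omega) (hj := rfl) (hj' := rfl))
      simp only [map_smul, consMap_val, val_cap_vertex_right i _ l r _ hm rfl] at e
      simpa only [Nat.zero_add, Nat.add_comm 2] using e

/-! ## Reduction to disjoint stars -/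

/-- Words that consist of vertices of valency at least `c` with all legs going down, to the left of
`n` vertical strands. -/
inductive Stars (c n : ℕ) : ℕ → List Slice → Prop
  | nil : Stars c n 0 []
  | snoc {m k a b j : ℕ} {w : List Slice} (hw : Stars c n m w) (hm : m = a + b) (hj : c ≤ j)
      (hk : k = a + j + b) : Stars c n k (w ++ [⟨a, .vertex 0 j, b + n⟩])

theorem Stars.isPath {c n m : ℕ} {w : List Slice} (h : Stars c n m w) : IsPath n w (m + n) := by
  induction h with
  | nil => exact (Nat.zero_add n).symm
  | snoc hw hm hj hk ih =>
    exact ih.snoc (by simp only [Slice.top, Piece.top]; omega)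
      (by simp only [Slice.bot, Piece.bot]; omega)

/-- Whatever disjoint stars with `m` legs are put over `v`, the result lies in `T`. -/
def Reduces {n : ℕ} (T : Submodule Coef (Y n)) (m : ℕ) (v : List Slice) : Prop :=
  ∀ w, Stars 0 n m w → ev n (w ++ v) ∈ T

variable {n : ℕ} {T : Submodule Coef (Y n)}

theorem ev_append_of_val {m : ℕ} {u v : List Slice} (hu : IsPath n u m)
    {x : {u : List Slice // IsPath n u m} → Y n} (e : val n m v = x) :
    ev n (u ++ v) = x ⟨u, hu⟩ :=
  congrFun e ⟨u, hu⟩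

theorem Reduces.congr {m : ℕ} {v v' : List Slice} (h : Reduces T m v)
    (e : val n (m + n) v' = val n (m + n) v) : Reduces T m v' := fun w hw => by
  rw [ev_append_of_val hw.isPath e]
  exact h w hw

theorem Reduces.vertex_zero {l j r m : ℕ} {v : List Slice} (h : Reduces T m v)
    (hm : m = l + j + r) : Reduces T (l + r) (⟨l, .vertex 0 j, r + n⟩ :: v) := fun w hw => by
  simpa using h _ (hw.snoc rfl (Nat.zero_le j) hm)

/-- If the upper leg hangs on the last star, that edge is contracted or deleted, and both outcomes
are stars again. Otherwise the last star slides below the vertex, is absorbed into `v`, and the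
induction continues with fewer stars. Deletion may leave a star without legs, which is why valency
zero is allowed here. -/
theorem Stars.vertex_one_mem {m : ℕ} {w : List Slice} (hw : Stars 0 n m w) {l k r m' : ℕ}
    {v : List Slice} (hm : m = l + 1 + r) (hm' : m' = l + k + r) (h : Reduces T m' v) :
    ev n (w ++ ⟨l, .vertex 1 k, r + n⟩ :: v) ∈ T := by
  induction hw generalizing l r v m' with
  | nil => omega
  | @snoc m₀ m a b j w hw h₀ _ h₁ ih =>
    rw [List.append_assoc, List.cons_append, List.nil_append]
    rcases lt_or_ge l a with hl | hl
    · obtain ⟨t, rfl⟩ := Nat.exists_eq_add_of_le hl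
      rw [ev_append_of_val hw.isPath (val_exchange (.vertex 1 k) (.vertex 0 j) l t (b + n)
        (l₁ := l + k + t) (r₁ := t + b + n) v).symm]
      have h' := h.vertex_zero (l := l + k + t) (j := j) (r := b) (by omega)
      exact ih (r := t + b) (by omega) (m' := l + k + t + b) (by omega) h'
    rcases lt_or_ge l (a + j) with hl' | hl'
    · obtain ⟨p, rfl⟩ := Nat.exists_eq_add_of_le hl
      rw [ev_append_of_val hw.isPath (val_contract k v p (j - p - 1) 0 a (b + n)
        (j₁ := p + k + (j - p - 1)) (j₂ := p + (j - p - 1)))]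
      refine T.sub_mem ?_ (T.smul_mem _ ?_)
      · simpa [val] using h _ (hw.snoc h₀ (Nat.zero_le (p + k + (j - p - 1))) (by omega))
      · have h' := h.vertex_zero (l := a + p) (j := k) (r := r) (by omega)
        simpa [val] using h' _ (hw.snoc h₀ (Nat.zero_le (p + (j - p - 1))) (by omega))
    · obtain ⟨t, rfl⟩ := Nat.exists_eq_add_of_le hl'
      rw [ev_append_of_val hw.isPath (val_exchange (.vertex 0 j) (.vertex 1 k) a t (r + n)
        (l₂ := a + t) (r₂ := t + k + r + n) v)]
      have h' := h.vertex_zero (l := a) (j := j) (r := t + k + r) (by omega)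
      exact ih (l := a + t) (r := r) (by omega) (m' := a + (t + k + r)) (by omega) h'

/-- The cases compare the ends of the cup with the legs of the last star: none in common, and the
star slides below the cup; one, and the cup makes the star a vertex with a single upper leg, to
which `Stars.vertex_one_mem` applies; two, and there is a loop. -/
theorem Stars.cup_mem {m : ℕ} {w : List Slice} (hw : Stars 0 n m w) {l r m' : ℕ}
    {v : List Slice} (hm : m = l + 2 + r) (hm' : m' = l + r) (h : Reduces T m' v) :
    ev n (w ++ ⟨l, .cup, r + n⟩ :: v) ∈ T := by
  induction hw generalizing l r v m' with
  | nil => omega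
  | @snoc m₀ m a b j w hw h₀ _ h₁ ih =>
    rw [List.append_assoc, List.cons_append, List.nil_append]
    -- A star without legs may lie between the two ends of the cup, where it can neither merge nor
    -- slide away, so it is removed beforehand.
    rcases Nat.eq_zero_or_pos j with rfl | hj
    · rw [ev_append_of_val hw.isPath (val_vertex_zero_zero a (b + n) _)]
      exact T.smul_mem _ (ih (by omega) hm' h)
    rcases lt_trichotomy (l + 1) a with hl | rfl | hl
    · obtain ⟨t, rfl⟩ := Nat.exists_eq_add_of_le hl
      rw [ev_append_of_val hw.isPath (val_exchange .cup (.vertex 0 j) l t (b + n)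
        (l₁ := l + t) (r₁ := t + b + n) v).symm]
      have h' := h.vertex_zero (l := l + t) (j := j) (r := b) (by omega)
      exact ih (r := t + b) (by omega) (m' := l + t + b) (by omega) h'
    · obtain ⟨j, rfl⟩ := Nat.exists_eq_add_of_le' hj
      rw [ev_append_of_val hw.isPath (val_vertex_cup_left 0 j l (b + n) v)]
      exact hw.vertex_one_mem h₀ (by omega) h
    rcases lt_trichotomy (l + 1) (a + j) with hl' | hl' | hl'
    · obtain ⟨p, rfl⟩ := Nat.exists_eq_add_of_le (Nat.le_of_lt_succ hl)
      rw [ev_append_of_val hw.isPath (val_loop v p (j - p - 2) 0 a (b + n)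
        (j' := p + (j - p - 2)))]
      refine T.smul_mem _ ?_
      simpa [val] using h _ (hw.snoc h₀ (Nat.zero_le (p + (j - p - 2))) (by omega))
    · obtain ⟨j, rfl⟩ := Nat.exists_eq_add_of_le' hj
      obtain rfl : b = r + 1 := by omega
      have e := val_vertex_cup_right (n := n) (m := m₀ + n) 0 j a (r + n) (l' := l) v
      rw [Nat.add_right_comm] at e
      rw [ev_append_of_val hw.isPath e]
      exact hw.vertex_one_mem (by omega) (by omega) h
    · obtain ⟨t, rfl⟩ : ∃ t, l = a + j + t := ⟨l - (a + j), by omega⟩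
      rw [ev_append_of_val hw.isPath (val_exchange (.vertex 0 j) .cup a t (r + n)
        (l₂ := a + t) (r₂ := t + r + n) v)]
      have h' := h.vertex_zero (l := a) (j := j) (r := t + r) (by omega)
      exact ih (l := a + t) (r := r) (by omega) (m' := a + (t + r)) (by omega) h'

theorem Reduces.cup {l r m m' : ℕ} {v : List Slice} (h : Reduces T m' v) (hm' : m' = l + r)
    (hm : m = l + 2 + r) : Reduces T m (⟨l, .cup, r + n⟩ :: v) :=
  fun _ hw => hw.cup_mem hm hm' h

theorem Reduces.cap {l r m m' : ℕ} {v : List Slice} (h : Reduces T m' v) (hm' : m' = l + 2 + r)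
    (hm : m = l + r) : Reduces T m (⟨l, .cap, r + n⟩ :: v) := by
  subst hm
  exact (h.vertex_zero hm').congr (val_cap l (r + n) v)

/-- The upper legs are pulled down one at a time on the right, each at the cost of one cup below. -/
theorem Reduces.vertex {i j l r m m' : ℕ} {v : List Slice} (h : Reduces T m' v)
    (hm' : m' = l + j + r) (hm : m = l + i + r) : Reduces T m (⟨l, .vertex i j, r + n⟩ :: v) := by
  induction i generalizing j r m m' v with
  | zero => subst hm; exact h.vertex_zero hm'
  | succ i ih =>
    have h' := ih (j := j + 1) (r := r + 1) (h.cup (l := l + j) hm' rfl) (by omega) rfl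
    subst hm
    have e := val_vertex_cup_right (n := n) (m := l + (i + 1) + r + n) i j l (r + n) (l' := l + j) v
    rw [Nat.add_right_comm r 1 n, show l + i + (r + 1) = l + (i + 1) + r by omega] at h'
    exact h'.congr e.symm

theorem Reduces.crossing {ε : Bool} {l r m : ℕ} {v : List Slice} (h : Reduces T m v)
    (hm : m = l + 2 + r) : Reduces T m (⟨l, .crossing ε, r + n⟩ :: v) := by
  have key : ∀ {l r m : ℕ} {v : List Slice}, Reduces T m v → m = l + 2 + r →
      Reduces T m (⟨l, .crossing true, r + n⟩ :: v) := fun {l r m v} h hm w hw => by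
    rw [ev_append_of_val hw.isPath (val_crossing_true l (r + n) v)]
    refine T.sub_mem (T.add_mem (T.smul_mem _ (h w hw)) (T.smul_mem _ ?_)) (T.smul_mem _ ?_)
    · exact (h.cap hm rfl).cup rfl hm w hw
    · exact h.vertex hm hm w hw
  cases ε with
  | true => exact key h hm
  | false =>
    -- The three slices of `val_crossing_false` are absorbed from the bottom upwards.
    have h₁ := h.cup (l := l + 2) (r := r) (m := m + 2) (by omega) (by omega)
    have h₂ := key (l := l + 1) (r := r + 1) h₁ (by omega)
    have h₃ := h₂.cap (l := l) (r := r + 2) (m := m) (by omega) (by omega)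
    have e := val_crossing_false (n := n) (m := m + n) l (r + n) v
    refine h₃.congr (e.trans ?_)
    rw [Nat.add_right_comm r 1 n, Nat.add_right_comm r 2 n]

theorem Reduces.append {k k' : ℕ} {w v : List Slice} (hw : IsPath k w k') (h : Reduces T k' v) :
    Reduces T k (w.map (Slice.widen 0 n) ++ v) := by
  induction w generalizing k with
  | nil => obtain rfl : k = k' := hw; exact h
  | cons s w ih =>
    obtain ⟨rfl, hw⟩ := hw
    have h' := ih hw
    obtain ⟨l, g, r⟩ := s
    rw [List.map_cons, Slice.widen, Nat.zero_add, List.cons_append]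
    cases g with
    | cup => exact h'.cup rfl rfl
    | cap => exact h'.cap rfl rfl
    | crossing ε => exact h'.crossing rfl
    | vertex i j => exact h'.vertex rfl rfl

/-- Vertices of valency less than two can be removed from disjoint stars. -/
theorem reduces_of_forall_stars_two {m : ℕ} {v : List Slice}
    (h : ∀ w, Stars 2 n m w → ev n (w ++ v) ∈ T) : Reduces T m v := by
  intro w hw
  induction hw generalizing v with
  | nil => exact h [] .nil
  | @snoc m₀ m a b j w hw h₀ _ h₁ ih =>
    rw [List.append_assoc, List.cons_append, List.nil_append]
    match j, h₁ with
    | 0, h₁ =>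
      rw [ev_append_of_val hw.isPath (val_vertex_zero_zero a (b + n) _)]
      obtain rfl : m₀ = m := by omega
      exact T.smul_mem _ (ih h)
    | 1, h₁ =>
      rw [ev_append_of_val hw.isPath (val_vertex_zero_one a (b + n) _)]
      exact T.zero_mem
    | j + 2, h₁ =>
      refine ih fun w' hw' => ?_
      simpa using h _ (hw'.snoc h₀ (Nat.le_add_left 2 j) h₁)

/-! ## Straightening words of cups and vertices -/

/-- Join a vertex `s` with a cup `t` below it, or a cap `s` with a vertex `t` below it, in case they
share exactly one strand. -/
def mergeSlices (s t : Slice) : Option Slice :=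
  match s.piece, t.piece with
  | .vertex i (j + 1), .cup =>
    if t.left = s.left + j then some ⟨s.left, .vertex (i + 1) j, t.right⟩
    else if t.left + 1 = s.left then some ⟨t.left, .vertex (i + 1) j, s.right⟩
    else none
  | .vertex 0 2, .vertex (i + 1) j =>
    if t.left = s.left + 1 then some ⟨s.left, .vertex i (j + 1), t.right⟩
    else if s.left = t.left + i then some ⟨t.left, .vertex i (j + 1), s.right⟩
    else none
  | _, _ => none

/-- Put a slice on top of a word: it moves down past pieces on its right and merges if it can. -/
def insertSlice : Slice → List Slice → List Slice
  | ⟨_, .vertex 1 1, _⟩, w => w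
  | s, [] => [s]
  | s, t :: w =>
    if s.bot = t.top then
      if t.piece.top ≠ 0 ∧ s.left + s.piece.bot ≤ t.left then
        ⟨t.left - s.piece.bot + s.piece.top, t.piece, t.right⟩ ::
          insertSlice ⟨s.left, s.piece, s.right - t.piece.top + t.piece.bot⟩ w
      else
        match mergeSlices s t with
        | some s' => insertSlice s' w
        | none => s :: t :: w
    else s :: t :: w

/-- Replace caps by bivalent vertices and insert the slices one after the other. -/
def straighten : List Slice → List Slice
  | [] => []
  | ⟨l, .cap, r⟩ :: w => insertSlice ⟨l, .vertex 0 2, r⟩ (straighten w)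
  | s :: w => insertSlice s (straighten w)

theorem val_mergeSlices {n : ℕ} {s t s' : Slice} (hst : s.bot = t.top)
    (h : mergeSlices s t = some s') (w : List Slice) :
    s'.top = s.top ∧ val n s.top (s :: t :: w) = val n s.top (s' :: w) := by
  obtain ⟨l, g, r⟩ := s
  obtain ⟨l', g', r'⟩ := t
  unfold mergeSlices at h
  split at h
  · rename_i i j hg hg'
    dsimp only at hg hg' h
    subst hg hg'
    simp only [Slice.top, Slice.bot, Piece.top, Piece.bot] at hst ⊢
    split_ifs at h with h₁ h₂
    · obtain rfl := Option.some.inj h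
      obtain rfl : r = r' + 1 := by omega
      exact ⟨by simp only; omega, val_vertex_cup_right i j l r' w⟩
    · obtain rfl := Option.some.inj h
      subst h₂
      exact ⟨by simp only; omega, val_vertex_cup_left i j l' r w⟩
  · rename_i i j hg hg'
    dsimp only at hg hg' h
    subst hg hg'
    simp only [Slice.top, Slice.bot, Piece.top, Piece.bot] at hst ⊢
    rw [← val_cap l r]
    split_ifs at h with h₁ h₂
    · obtain rfl := Option.some.inj h
      subst h₁
      exact ⟨by simp only; omega, val_cap_vertex_left i j l r' w⟩
    · obtain rfl := Option.some.inj h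
      obtain rfl : r' = r + 1 := by omega
      exact ⟨by simp only; omega, val_cap_vertex_right i j l' r w⟩
  · cases h

/-- Each step of the algorithm is the removal of a bivalent vertex, an exchange of heights or the
straightening of a zigzag. -/
theorem val_insertSlice {n : ℕ} (s : Slice) (w : List Slice) :
    val n s.top (insertSlice s w) = val n s.top (s :: w) := by
  induction w generalizing s with
  | nil =>
    unfold insertSlice
    split
    · exact (val_vertex_one_one _ _ _ rfl).symm
    · rfl
    · contradiction
  | cons t w ih =>
    unfold insertSlice
    split
    · exact (val_vertex_one_one _ _ _ rfl).symm
    · contradiction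
    · rename_i heq
      obtain ⟨rfl, rfl⟩ := List.cons.inj heq
      rename_i s _ _ _
      split_ifs with h₁ h₂
      · obtain ⟨l, g, r⟩ := s
        obtain ⟨l', h, r'⟩ := t
        simp only [Slice.top, Slice.bot] at h₁ h₂ ⊢
        rw [val_cons_congr (k := l + g.top + (r - h.top + h.bot))
          (by simp only [Slice.top]; omega) (by simp only [Slice.bot]; omega) (ih ⟨l, g, _⟩)]
        exact (val_exchange g h l (l' - (l + g.bot)) r' _ (by omega) (by omega) (by omega)
          (by omega) (by omega)).symm
      · split
        · rename_i s' hs'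
          obtain ⟨e, e'⟩ := val_mergeSlices (n := n) h₁ hs' w
          rw [e', ← e, ih]
        · rfl
      · rfl

/-- Uniqueness of the straightened word is not needed: on explicit words `straighten` is evaluated
by definitional unfolding, and the results are compared directly. -/
theorem val_straighten {n m k : ℕ} {w : List Slice} (hw : IsPath m w k) :
    val n m (straighten w) = val n m w := by
  induction w generalizing m with
  | nil => rfl
  | cons s w ih =>
    obtain ⟨rfl, hw⟩ := hw
    unfold straighten
    split
    · contradiction
    · rename_i l r w' heq
      obtain ⟨rfl, rfl⟩ := List.cons.inj heq
      have e := (val_insertSlice (n := n) ⟨l, .vertex 0 2, r⟩ (straighten w)).trans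
        (val_cons_congr rfl rfl (ih hw))
      exact e.trans (val_cap l r w rfl).symm
    · rename_i heq
      obtain ⟨rfl, rfl⟩ := List.cons.inj heq
      exact (val_insertSlice _ _).trans (val_cons_congr rfl rfl (ih hw))

theorem ev_straighten {n : ℕ} {w : List Slice} (hw : IsPath n w n) :
    ev n (straighten w) = ev n w :=
  congrFun (val_straighten hw) ⟨[], rfl⟩

theorem ev_nil {n : ℕ} : ev n [] = 1 := ev_word (1 : Diagram n n)

theorem ev_append {n : ℕ} {w w' : List Slice} (hw : IsPath n w n) (hw' : IsPath n w' n) :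
    ev n (w ++ w') = ev n w * ev n w' := by
  rw [ev_of_isPath hw, ev_of_isPath hw', ← ofDiagram_mul, ← ev_word]
  rfl

/-! ## Bending ribbon `3`-graphs -/

/-- A cup on the right of a word can be moved below it. -/
theorem val_cup_append {n k k' : ℕ} {w : List Slice} (hw : IsPath k w k') (v : List Slice)
    (c r : ℕ) {a b m : ℕ} (ha : a = c + 2 + r := by omega) (hb : b = c + r := by omega)
    (hm : m = k + a := by omega) :
    val n m (w.map (Slice.widen 0 a) ++ ⟨k' + c, .cup, r⟩ :: v) =
      val n m (⟨k + c, .cup, r⟩ :: (w.map (Slice.widen 0 b) ++ v)) := by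
  subst ha hb hm
  induction w generalizing k with
  | nil => obtain rfl : k = k' := hw; rfl
  | cons s w ih =>
    obtain ⟨rfl, hw⟩ := hw
    obtain ⟨l, g, r₀⟩ := s
    simp only [List.map_cons, Slice.widen, List.cons_append, Nat.zero_add]
    rw [val_cons_congr (k := l + g.bot + r₀ + (c + 2 + r))
      (by simp only [Slice.top]; omega) (by simp only [Slice.bot]; omega) (ih hw)]
    simp only [Slice.top]
    exact val_exchange g .cup l (r₀ + c) r _ (by simp only [Piece.top]; omega)
      (by simp only [Piece.top]; omega) (by omega) (by omega) (by simp only [Piece.bot]; omega)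

/-- The cups that join the last three of six end points with three vertical strands. -/
def bendCups : List Slice := [⟨5, .cup, 2⟩, ⟨4, .cup, 1⟩, ⟨3, .cup, 0⟩]

/-- Under three nested caps the legs 1, 2, 3 are connected with 6, 5, 4, and `bendCups` connects 6,
5, 4 with the three vertical strands. Acting on the first three legs is therefore the same as acting
on the strands that come from the top line. -/
theorem ofDiagram_mem_of_reduces {T : Submodule Coef (Y 3)} (h : Reduces T 6 bendCups)
    (x : Diagram 3 3) : Y.ofDiagram x ∈ T := by
  obtain ⟨w, hw⟩ := x
  have hs : Stars 0 3 6 [⟨0, .vertex 0 2, 3⟩, ⟨1, .vertex 0 2, 4⟩, ⟨2, .vertex 0 2, 5⟩] :=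
    ((Stars.nil.snoc (a := 0) (b := 0) rfl (Nat.zero_le 2) rfl).snoc (a := 1) (b := 1) rfl
      (Nat.zero_le 2) rfl).snoc (a := 2) (b := 2) rfl (Nat.zero_le 2) rfl
  have h' := h.append (hw.widen 0 3) _ hs
  have e₁ : (w.map (Slice.widen 0 3)).map (Slice.widen 0 3) = w.map (Slice.widen 0 6) := by
    simp [Slice.widen, Function.comp_def]
  have e₂ : w.map (Slice.widen 0 0) = w := by
    exact List.map_id'' (fun s => by simp [Slice.widen]) w
  have e₃ : val 3 9 (w.map (Slice.widen 0 6) ++ bendCups) = val 3 9 (bendCups ++ w) := by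
    have c₁ := val_cup_append (n := 3) hw [⟨4, .cup, 1⟩, ⟨3, .cup, 0⟩] 2 2
      (a := 6) (b := 4) (m := 9)
    have c₂ := val_cup_append (n := 3) hw [⟨3, .cup, 0⟩] 1 1 (a := 4) (b := 2) (m := 7)
    have c₃ := val_cup_append (n := 3) hw [] 0 0 (a := 2) (b := 0) (m := 5)
    rw [e₂, List.append_nil] at c₃
    exact c₁.trans (val_cons_congr (m := 9) (k := 7) rfl rfl
      (c₂.trans (val_cons_congr (m := 7) (k := 5) rfl rfl c₃)))
  rw [e₁, ev_append_of_val hs.isPath e₃] at h'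
  have hc : IsPath 3 ([⟨0, .vertex 0 2, 3⟩, ⟨1, .vertex 0 2, 4⟩, ⟨2, .vertex 0 2, 5⟩] ++
      bendCups) 3 := ⟨rfl, rfl, rfl, rfl, rfl, rfl, rfl⟩
  -- The nested caps over `bendCups` are three zigzags, so they straighten to the empty word.
  rw [← ev_of_isPath hw, ← one_mul (ev 3 w), ← ev_nil, ← show straighten ([⟨0, .vertex 0 2, 3⟩,
    ⟨1, .vertex 0 2, 4⟩, ⟨2, .vertex 0 2, 5⟩] ++ bendCups) = [] from rfl, ev_straighten hc,
    ← ev_append hc hw, List.append_assoc]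
  exact h'

/-! ## The generators -/

/-- The subalgebra of `𝒴₃` that is generated by `A`, `B`, `C`, `F`, `G`, `N`, as a submodule. -/
noncomputable def generated : Submodule Coef (Y 3) :=
  Subalgebra.toSubmodule (Algebra.adjoin Coef
    {Y.ofDiagram diagramA, Y.ofDiagram diagramB, Y.ofDiagram diagramC, Y.ofDiagram diagramF,
      Y.ofDiagram diagramG, Y.ofDiagram diagramN})

theorem ev_append_mem {w w' : List Slice} (hw : IsPath 3 w 3) (hw' : IsPath 3 w' 3)
    (h : ev 3 w ∈ generated) (h' : ev 3 w' ∈ generated) : ev 3 (w ++ w') ∈ generated := by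
  rw [ev_append hw hw']
  exact Subalgebra.mul_mem _ h h'

theorem generator_mem {x : Diagram 3 3} (h : Y.ofDiagram x ∈ ({Y.ofDiagram diagramA,
    Y.ofDiagram diagramB, Y.ofDiagram diagramC, Y.ofDiagram diagramF, Y.ofDiagram diagramG,
    Y.ofDiagram diagramN} : Set (Y 3))) : ev 3 x.word ∈ generated := by
  rw [ev_word]
  exact Algebra.subset_adjoin h

theorem ev_diagramB_mem : ev 3 diagramB.word ∈ generated := generator_mem (by simp)
theorem ev_diagramC_mem : ev 3 diagramC.word ∈ generated := generator_mem (by simp)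
theorem ev_diagramF_mem : ev 3 diagramF.word ∈ generated := generator_mem (by simp)
theorem ev_diagramG_mem : ev 3 diagramG.word ∈ generated := generator_mem (by simp)
theorem ev_diagramN_mem : ev 3 diagramN.word ∈ generated := generator_mem (by simp)

theorem ev_nil_mem : ev 3 [] ∈ generated := by
  rw [ev_nil]
  exact Subalgebra.one_mem _

theorem ev_mem_of_straighten {w : List Slice} (hw : IsPath 3 w 3)
    (h : ev 3 (straighten w) ∈ generated) : ev 3 w ∈ generated := by
  rwa [← ev_straighten hw]

theorem ev_straighten_mem {w : List Slice} (hw : IsPath 3 w 3) (h : ev 3 w ∈ generated) :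
    ev 3 (straighten w) ∈ generated := by
  rwa [ev_straighten hw]

theorem ev_cup_vertex_mem : ev 3 [⟨0, .cup, 1⟩, ⟨0, .vertex 1 3, 0⟩] ∈ generated := by
  have h := ev_append_mem diagramB.isPath diagramF.isPath ev_diagramB_mem ev_diagramF_mem
  have e := val_cons_congr (n := 3) (m := 3) (s := ⟨0, .cup, 1⟩) rfl rfl
    (val_cap_vertex_left (n := 3) 1 2 0 0 [] rfl rfl)
  have e' : ev 3 (diagramB.word ++ diagramF.word) = ev 3 [⟨0, .cup, 1⟩, ⟨0, .vertex 1 3, 0⟩] :=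
    congrFun e ⟨[], rfl⟩
  rwa [← e']

/-! ### Pairs of trivalent vertices from the edge relation -/

theorem d_mul_dInv : d * dInv = 1 := IsLocalization.Away.mul_invSelf dPoly

theorem mem_of_eq_sub_dInv_smul {x y z : Y 3} (h : x = y - dInv • z) (hx : x ∈ generated)
    (hy : y ∈ generated) : z ∈ generated := by
  have e : z = d • (y - x) := by
    rw [h, sub_sub_cancel, smul_smul, d_mul_dInv, one_smul]
  rw [e]
  exact Submodule.smul_mem _ _ (Submodule.sub_mem _ hy hx)

/-- Two trivalent vertices, joined to the end points on the top and on the bottom line. -/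
theorem ev_vertex_three_zero_mem :
    ev 3 [⟨0, .vertex 3 0, 0⟩, ⟨0, .vertex 0 3, 0⟩] ∈ generated := by
  -- In `GCBF` two four-valent vertices are joined by a single edge: `GC` straightens to a vertex
  -- with three upper legs over a cap, and `BF` to a cup over a vertex with three lower legs.
  have h := ev_append_mem (diagramG * diagramC).isPath (diagramB * diagramF).isPath
    (ev_append_mem diagramG.isPath diagramC.isPath ev_diagramG_mem ev_diagramC_mem)
    (ev_append_mem diagramB.isPath diagramF.isPath ev_diagramB_mem ev_diagramF_mem)
  have e : ev 3 [⟨0, .vertex 3 1, 0⟩, ⟨0, .vertex 1 3, 0⟩] = ev 3 diagramN.word -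
      dInv • ev 3 [⟨0, .vertex 3 0, 0⟩, ⟨0, .vertex 0 3, 0⟩] :=
    congrFun (val_vertex_vertex (n := 3) (m := 3) 3 3 0 0 []) ⟨[], rfl⟩
  exact mem_of_eq_sub_dInv_smul e
    (ev_straighten_mem ((diagramG * diagramC) * (diagramB * diagramF)).isPath h) ev_diagramN_mem

/-- Two trivalent vertices, one joined to the second and the third end point on the top line. -/
theorem ev_vertex_two_one_right_mem :
    ev 3 [⟨1, .vertex 2 1, 0⟩, ⟨0, .vertex 1 2, 1⟩] ∈ generated := by
  -- This is `FG` with the outer upper leg of the lower vertex pulled down to a cup, so that the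
  -- edge to be contracted is its only upper leg.
  have e : ev 3 [⟨1, .vertex 2 2, 0⟩, ⟨1, .vertex 1 3, 1⟩, ⟨0, .cup, 3⟩] =
      ev 3 [⟨1, .vertex 2 4, 0⟩, ⟨0, .cup, 3⟩] -
        dInv • ev 3 [⟨1, .vertex 2 1, 0⟩, ⟨1, .vertex 0 3, 1⟩, ⟨0, .cup, 3⟩] :=
    congrFun (val_contract (n := 3) (m := 3) 3 [⟨0, .cup, 3⟩] 0 1 2 1 0) ⟨[], rfl⟩
  refine ev_straighten_mem (w := [⟨1, .vertex 2 1, 0⟩, ⟨1, .vertex 0 3, 1⟩, ⟨0, .cup, 3⟩])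
    ⟨rfl, rfl, rfl, rfl⟩ (mem_of_eq_sub_dInv_smul e ?_ ?_)
  · exact ev_mem_of_straighten ⟨rfl, rfl, rfl, rfl⟩
      (ev_append_mem diagramF.isPath diagramG.isPath ev_diagramF_mem ev_diagramG_mem)
  · exact ev_mem_of_straighten ⟨rfl, rfl, rfl⟩ ev_diagramN_mem

/-- Two trivalent vertices, one joined to the first and the second end point on the top line. -/
theorem ev_vertex_two_one_left_mem :
    ev 3 [⟨0, .vertex 2 1, 1⟩, ⟨1, .vertex 1 2, 0⟩] ∈ generated := by
  have e : ev 3 [⟨0, .vertex 2 2, 1⟩, ⟨1, .vertex 1 3, 1⟩, ⟨3, .cup, 0⟩] =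
      ev 3 [⟨0, .vertex 2 4, 1⟩, ⟨3, .cup, 0⟩] -
        dInv • ev 3 [⟨0, .vertex 2 1, 1⟩, ⟨1, .vertex 0 3, 1⟩, ⟨3, .cup, 0⟩] :=
    congrFun (val_contract (n := 3) (m := 3) 3 [⟨3, .cup, 0⟩] 1 0 2 0 1) ⟨[], rfl⟩
  -- The goal is not in straightened form, since its right vertex moves above its left one; both
  -- words are compared after straightening.
  refine ev_mem_of_straighten ⟨rfl, rfl, rfl⟩
    (ev_straighten_mem (w := [⟨0, .vertex 2 1, 1⟩, ⟨1, .vertex 0 3, 1⟩, ⟨3, .cup, 0⟩])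
      ⟨rfl, rfl, rfl, rfl⟩ (mem_of_eq_sub_dInv_smul e ?_ ?_))
  · exact ev_mem_of_straighten ⟨rfl, rfl, rfl, rfl⟩
      (ev_append_mem diagramG.isPath diagramF.isPath ev_diagramG_mem ev_diagramF_mem)
  · exact ev_mem_of_straighten ⟨rfl, rfl, rfl⟩ ev_diagramN_mem

/-! ## Stars with six legs -/

theorem Stars.two_cases {n m : ℕ} {w : List Slice} (h : Stars 2 n m w) :
    m = 0 ∧ w = [] ∨ ∃ (a b j : ℕ) (w' : List Slice), Stars 2 n (a + b) w' ∧ 2 ≤ j ∧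
      m = a + j + b ∧ w = w' ++ [⟨a, .vertex 0 j, b + n⟩] := by
  cases h with
  | nil => exact .inl ⟨rfl, rfl⟩
  | snoc hw hm hj hk => exact .inr ⟨_, _, _, _, hm ▸ hw, hj, hk, rfl⟩

theorem Stars.two_zero {n : ℕ} {w : List Slice} (h : Stars 2 n 0 w) : w = [] := by
  obtain ⟨-, rfl⟩ | ⟨a, b, j, w', -, hj, hm, -⟩ := h.two_cases
  · rfl
  · omega

/-- Two stars of valency at least two already need four legs. -/
theorem Stars.two_lt_four {n m : ℕ} {w : List Slice} (h : Stars 2 n m w) (h₀ : 0 < m)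
    (h₄ : m < 4) : 2 ≤ m ∧ w = [⟨0, .vertex 0 m, n⟩] := by
  obtain ⟨rfl, -⟩ | ⟨a, b, j, w', hw', hj, hm, rfl⟩ := h.two_cases
  · omega
  · obtain ⟨h₀', rfl⟩ | ⟨a', b', j', -, -, hj', hm', -⟩ := hw'.two_cases
    · obtain rfl : a = 0 := by omega
      obtain rfl : b = 0 := by omega
      obtain rfl : m = j := by omega
      exact ⟨hj, by simp⟩
    · omega

theorem Stars.two_four {n : ℕ} {w : List Slice} (h : Stars 2 n 4 w) :
    w = [⟨0, .vertex 0 4, n⟩] ∨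
      ∃ a b, a + b = 2 ∧ w = [⟨0, .vertex 0 2, n⟩, ⟨a, .vertex 0 2, b + n⟩] := by
  obtain ⟨h₀, -⟩ | ⟨a, b, j, w', hw', hj, hm, rfl⟩ := h.two_cases
  · omega
  rcases Nat.eq_zero_or_pos (a + b) with h₀ | h₀
  · obtain ⟨rfl, rfl⟩ : a = 0 ∧ b = 0 := by omega
    obtain rfl : j = 4 := by omega
    exact .inl (by simp [hw'.two_zero])
  · obtain ⟨h₂, rfl⟩ := hw'.two_lt_four h₀ (by omega)
    obtain rfl : j = 2 := by omega
    have h₂ : a + b = 2 := by omega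
    exact .inr ⟨a, b, h₂, by simp [h₂]⟩

theorem reduces_bendCups : Reduces generated 6 bendCups := by
  have hB := ev_straighten_mem diagramB.isPath ev_diagramB_mem
  have hC := ev_straighten_mem diagramC.isPath ev_diagramC_mem
  have hBC := ev_straighten_mem (diagramB * diagramC).isPath
    (ev_append_mem diagramB.isPath diagramC.isPath ev_diagramB_mem ev_diagramC_mem)
  have hCB := ev_straighten_mem (diagramC * diagramB).isPath
    (ev_append_mem diagramC.isPath diagramB.isPath ev_diagramC_mem ev_diagramB_mem)
  have hFB := ev_straighten_mem (diagramF * diagramB).isPath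
    (ev_append_mem diagramF.isPath diagramB.isPath ev_diagramF_mem ev_diagramB_mem)
  have hCG := ev_straighten_mem (diagramC * diagramG).isPath
    (ev_append_mem diagramC.isPath diagramG.isPath ev_diagramC_mem ev_diagramG_mem)
  have hGC := ev_straighten_mem (diagramG * diagramC).isPath
    (ev_append_mem diagramG.isPath diagramC.isPath ev_diagramG_mem ev_diagramC_mem)
  have hX := ev_straighten_mem (w := [⟨0, .vertex 2 1, 1⟩, ⟨1, .vertex 1 2, 0⟩]) ⟨rfl, rfl, rfl⟩
    ev_vertex_two_one_left_mem
  refine reduces_of_forall_stars_two fun w hw =>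
    ev_mem_of_straighten (hw.isPath.append (k := 9) ⟨rfl, rfl, rfl, rfl⟩) ?_
  -- Legs 1, 2, 3 are the bottom points from left to right, and legs 4, 5, 6 are the top points from
  -- right to left. The cases follow the number `a + b` of legs that do not belong to the last star.
  -- A partition recurs when its stars can be created in several orders.
  obtain ⟨h₀, -⟩ | ⟨a, b, j, w', hw', hj, hm, rfl⟩ := hw.two_cases
  · omega
  rcases Nat.eq_zero_or_pos (a + b) with h₀ | h₀
  · obtain ⟨rfl, rfl⟩ : a = 0 ∧ b = 0 := by omega
    obtain rfl : j = 6 := by omega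
    rw [hw'.two_zero]
    exact ev_diagramN_mem
  rcases Nat.lt_or_ge (a + b) 4 with h₄ | h₄
  · obtain ⟨h₂, rfl⟩ := hw'.two_lt_four h₀ h₄
    obtain ⟨h₃, rfl⟩ | ⟨h₃, rfl⟩ : (a + b = 3 ∧ j = 3) ∨ (a + b = 2 ∧ j = 4) := by omega
    · rw [h₃]
      obtain ⟨rfl, rfl⟩ | ⟨rfl, rfl⟩ | ⟨rfl, rfl⟩ | ⟨rfl, rfl⟩ : (a = 0 ∧ b = 3) ∨
        (a = 1 ∧ b = 2) ∨ (a = 2 ∧ b = 1) ∨ (a = 3 ∧ b = 0) := by omega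
      · exact ev_vertex_three_zero_mem
      · exact hX
      · exact ev_vertex_two_one_right_mem
      · exact ev_vertex_three_zero_mem
    · rw [h₃]
      obtain ⟨rfl, rfl⟩ | ⟨rfl, rfl⟩ | ⟨rfl, rfl⟩ : (a = 0 ∧ b = 2) ∨ (a = 1 ∧ b = 1) ∨
        (a = 2 ∧ b = 0) := by omega
      · exact ev_cup_vertex_mem
      · exact ev_diagramF_mem
      · exact hFB
  · obtain ⟨h₂, rfl⟩ : a + b = 4 ∧ j = 2 := by omega
    have h₅ : (a = 0 ∧ b = 4) ∨ (a = 1 ∧ b = 3) ∨ (a = 2 ∧ b = 2) ∨ (a = 3 ∧ b = 1) ∨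
      (a = 4 ∧ b = 0) := by omega
    rw [h₂] at hw'
    obtain rfl | ⟨a', b', h', rfl⟩ := hw'.two_four
    · obtain ⟨rfl, rfl⟩ | ⟨rfl, rfl⟩ | ⟨rfl, rfl⟩ | ⟨rfl, rfl⟩ | ⟨rfl, rfl⟩ := h₅
      · exact hFB
      · exact hGC
      · exact ev_diagramG_mem
      · exact hCG
      · exact ev_cup_vertex_mem
    · obtain ⟨rfl, rfl⟩ | ⟨rfl, rfl⟩ | ⟨rfl, rfl⟩ : (a' = 0 ∧ b' = 2) ∨ (a' = 1 ∧ b' = 1) ∨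
        (a' = 2 ∧ b' = 0) := by omega
      · obtain ⟨rfl, rfl⟩ | ⟨rfl, rfl⟩ | ⟨rfl, rfl⟩ | ⟨rfl, rfl⟩ | ⟨rfl, rfl⟩ := h₅
        exacts [hB, hBC, hB, hCB, hB]
      · obtain ⟨rfl, rfl⟩ | ⟨rfl, rfl⟩ | ⟨rfl, rfl⟩ | ⟨rfl, rfl⟩ | ⟨rfl, rfl⟩ := h₅
        exacts [hCB, hC, ev_nil_mem, hC, hBC]
      · obtain ⟨rfl, rfl⟩ | ⟨rfl, rfl⟩ | ⟨rfl, rfl⟩ | ⟨rfl, rfl⟩ | ⟨rfl, rfl⟩ := h₅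
        exacts [hB, hBC, hB, hCB, hB]

end RibbonSkein

/-- The `𝓡`-algebra `𝒴₃` is generated by the six elements `A`, `B`, `C`, `F`, `G`, `N`. -/
theorem theorem1p2 :
    Algebra.adjoin RibbonSkein.Coef
      ({RibbonSkein.Y.ofDiagram RibbonSkein.diagramA, RibbonSkein.Y.ofDiagram RibbonSkein.diagramB,
        RibbonSkein.Y.ofDiagram RibbonSkein.diagramC, RibbonSkein.Y.ofDiagram RibbonSkein.diagramF,
        RibbonSkein.Y.ofDiagram RibbonSkein.diagramG, RibbonSkein.Y.ofDiagram RibbonSkein.diagramN} :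
        Set (RibbonSkein.Y 3)) = ⊤ := by
  refine eq_top_iff.2 fun y _ => ?_
  obtain ⟨z, rfl⟩ := Ideal.Quotient.mk_surjective y
  induction z using MonoidAlgebra.induction_linear with
  | zero => rw [map_zero]; exact Subalgebra.zero_mem _
  | add z z' h h' => rw [map_add]; exact Subalgebra.add_mem _ (h trivial) (h' trivial)
  | single g c =>
    induction g using Con.induction_on with
    | H x =>
      have h := Submodule.smul_mem _ c
        (RibbonSkein.ofDiagram_mem_of_reduces RibbonSkein.reduces_bendCups x)
      have e := RibbonSkein.mk_linComb [(c, x)]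
      simp only [RibbonSkein.linComb, List.map_cons, List.map_nil, List.sum_cons, List.sum_nil,
        add_zero] at e
      rw [← e] at h
      exact h
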